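/- Let $q$ be a prime power, let $d\ge 2$ be an even integer, and let $k,n_1,n_2,t$ be integers with $k\ge d$, $n_1\ge k$, $n_2\ge k$ and $0\le t\le n_1-k$. Let $A_q(n,k,d)$ be the maximum number of $k$-dimensional subspaces of $\mathbb F_q^n$ such that any two distinct ones $U,W$ satisfy $\dim(U+W)-\dim(U\cap W)\ge d$. For $\delta\ge1$, a linear MRD code of $m\times n$ matrices with rank distance $\delta$ is an $\mathbb F_q$-subspace $Q$ of $\mathbb F_q^{m\times n}$ such that $\operatorname{rank}(A-B)\ge\delta$ for all distinct $A,B\in Q$ and $|Q|=\lceil q^{\max\{m,n\}(\min\{m,n\}-\delta+1)}\rceil$; write $A_r(Q)$ for the number of elements of $Q$ of rank $r$. Then linear MRD codes with rank distance $d/2$ exist in $\mathbb F_q^{n_1\times k}$ and in $\mathbb F_q^{(n_2+t)\times k}$, and for every such code $Q_q(n_1,k,\tfrac d2)$ in the first space and every such code $Q_q(n_2+t,k,\tfrac d2)$ in the second, $$A_q(n_1+n_2,k,d)\ \ge\ \bigl|Q_q(n_1,k,\tfrac d2)\bigr|\cdot A_q(n_2,k,d)+A_q(n_1-t,k,d)\cdot\Bigl(1+\sum_{r=d/2}^{k-d/2}A_r\bigl(Q_q(n_2+t,k,\tfrac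 d2)\bigr)\Bigr).$$ Moreover, for $d/2\le r\le k-d/2$, with $m=n_2+t$ and $\delta=d/2$, the number $A_r(Q_q(m,k,\delta))$ is given by Delsarte's formula $$A_r(Q_q(m,k,\delta))=\binom{k}{r}_q\sum_{i=0}^{r-\delta}(-1)^i q^{\binom i2}\binom{r}{i}_q\left(\frac{q^{m(k-\delta+1)}}{q^{m(k+i-r)}}-1\right),\qquad \binom{a}{b}_q=\prod_{i=0}^{b-1}\frac{q^{a-i}-1}{q^{b-i}-1}.$$ -/

import Mathlib

/-- The subspace distance `dim (U + W) - dim (U ∩ W)`. -/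
noncomputable def subspaceDist {F : Type*} [Field F] {n : ℕ}
    (U W : Submodule F (Fin n → F)) : ℕ :=
  Module.finrank F ↥(U ⊔ W) - Module.finrank F ↥(U ⊓ W)

/-- `C` is a constant dimension code in `F ^ n`: a set of `k`-dimensional subspaces, any two
distinct ones at subspace distance at least `d`. -/
def IsConstDimCode {F : Type*} [Field F] {n : ℕ} (k d : ℕ)
    (C : Set (Submodule F (Fin n → F))) : Prop :=
  (∀ U ∈ C, Module.finrank F ↥U = k) ∧ ∀ U ∈ C, ∀ W ∈ C, U ≠ W → d ≤ subspaceDist U W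

/-- `A_q(n, k, d)`, the largest cardinality of a constant dimension code of `k`-dimensional
subspaces of `F ^ n` with distance at least `d`, where `F` is the field with `q` elements. -/
noncomputable def maxCodeSize (F : Type*) [Field F] (n k d : ℕ) : ℕ :=
  sSup {M : ℕ | ∃ C : Set (Submodule F (Fin n → F)), IsConstDimCode k d C ∧ C.ncard = M}

/-- Over a finite field the supremum in `maxCodeSize` is an attained maximum. -/
theorem maxCodeSize_isGreatest (F : Type*) [Field F] [Finite F] (n k d : ℕ) :
    IsGreatest {M : ℕ | ∃ C : Set (Submodule F (Fin n → F)), IsConstDimCode k d C ∧ C.ncard = M}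
      (maxCodeSize F n k d) := by
  have hb : BddAbove {M : ℕ | ∃ C : Set (Submodule F (Fin n → F)),
      IsConstDimCode k d C ∧ C.ncard = M} := by
    refine ⟨Nat.card (Submodule F (Fin n → F)), ?_⟩
    rintro M ⟨C, -, rfl⟩
    exact Set.ncard_le_card C
  refine ⟨Nat.sSup_mem ⟨0, ∅, ⟨by simp, by simp⟩, by simp⟩ hb, fun M hM => le_csSup hb hM⟩

/-- `Q` is a linear MRD code of `m × n` matrices with rank distance `δ`: distinct codewords are at
rank distance at least `δ` and `Q` has `⌈q ^ (max m n * (min m n - δ + 1))⌉` elements, the maximum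
possible. (Truncated subtraction in the exponent has the effect of the ceiling.) -/
def IsLinearMRD {F : Type*} [Field F] {m n : ℕ} (δ : ℕ)
    (Q : Submodule F (Matrix (Fin m) (Fin n) F)) : Prop :=
  (∀ A ∈ Q, ∀ B ∈ Q, A ≠ B → δ ≤ (A - B).rank) ∧
    Nat.card ↥Q = Nat.card F ^ (max m n * (min m n + 1 - δ))

/-- `A_r(Q)`, the number of codewords of rank `r` in `Q`. -/
noncomputable def rankCount {F : Type*} [Field F] {m n : ℕ}
    (Q : Submodule F (Matrix (Fin m) (Fin n) F)) (r : ℕ) : ℕ :=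
  {A : Matrix (Fin m) (Fin n) F | A ∈ Q ∧ A.rank = r}.ncard

/-- The Gaussian binomial coefficient
`∏ i < b, (q ^ (a - i) - 1) / (q ^ (b - i) - 1)`; it vanishes for `a < b`. -/
def gaussBinom (q a b : ℕ) : ℚ :=
  ∏ i ∈ Finset.range b, ((q : ℚ) ^ (a - i) - 1) / ((q : ℚ) ^ (b - i) - 1)

/-- Delsarte's expression for the number of codewords of rank `r` in an MRD code of `m × n`
matrices with rank distance `δ`, for `n ≤ m` and `δ ≤ r ≤ n`. -/
def delsarteCount (q m n δ r : ℕ) : ℚ :=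
  gaussBinom q n r * ∑ i ∈ Finset.range (r - δ + 1),
    (-1) ^ i * (q : ℚ) ^ (Nat.choose i 2) * gaussBinom q r i *
      ((q : ℚ) ^ (m * (n - δ + 1)) / (q : ℚ) ^ (m * (n + i - r)) - 1)

/-! The bound glues two families of `k`-spaces in `F ^ (n₁ + n₂)`. The first consists of the spaces
`{(M x, φ x)}`, with `M ∈ Q₁` and `φ` parametrizing a word of an optimal code in `F ^ n₂`. For the
second, the space is resplit as `F ^ (n₁ - t) × F ^ (n₂ + t)`; its members are `{(ψ x, N x)}`, with
`ψ` from an optimal code in `F ^ (n₁ - t)` and `N ∈ Q₂` of rank at most `k - d/2`. Distance `d`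
means intersections of dimension at most `k - d/2`. Within a family this comes from the subspace
code or, when the code words agree, from the rank distance (`finrank_range_inf_le_of_proj`). Across
families, projection to `F ^ n₂` is injective on the first kind, while the second kind has image of
dimension at most `rank N`. MRD codes exist because a nonzero linearized polynomial has few roots.
The rank distribution follows by counting pairs of a codeword and an independent family in its
kernel (`IsLinearMRD.sum_frameCount`), then inverting with Gaussian binomials. -/

/-! ### Gaussian binomial identities. -/

section GaussBinom

/-- The product `∏ i < b, (q ^ a - q ^ i)`, the number of linearly independent `b`-tuples in an
`a`-dimensional space over the field with `q` elements. -/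
def frameCount (q a b : ℕ) : ℚ :=
  ∏ i ∈ Finset.range b, ((q : ℚ) ^ a - (q : ℚ) ^ i)

theorem frameCount_succ (q a b : ℕ) :
    frameCount q a (b + 1) = frameCount q a b * ((q : ℚ) ^ a - (q : ℚ) ^ b) :=
  Finset.prod_range_succ _ _

theorem frameCount_eq_zero {q a b : ℕ} (h : a < b) : frameCount q a b = 0 :=
  Finset.prod_eq_zero (Finset.mem_range.2 h) (sub_self _)

theorem frameCount_succ_succ (q a b : ℕ) :
    frameCount q (a + 1) (b + 1) =
      ((q : ℚ) ^ (a + 1) - 1) * (q : ℚ) ^ b * frameCount q a b := by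
  rw [frameCount, Finset.prod_range_succ', pow_zero, frameCount,
    Finset.prod_congr rfl fun i _ =>
      (by ring : (q : ℚ) ^ (a + 1) - (q : ℚ) ^ (i + 1) = q * ((q : ℚ) ^ a - (q : ℚ) ^ i)),
    Finset.prod_mul_distrib, Finset.prod_const, Finset.card_range]
  ring

/-- After `j` vectors are chosen, the other `i` form a frame modulo their span, and each has `q ^ j`
lifts. -/
theorem frameCount_add (q j n i : ℕ) :
    frameCount q (j + n) (j + i) =
      frameCount q (j + n) j * (q : ℚ) ^ (j * i) * frameCount q n i := by
  rw [frameCount, Finset.prod_range_add, ← frameCount, frameCount,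
    Finset.prod_congr rfl fun l _ =>
      (by ring : (q : ℚ) ^ (j + n) - (q : ℚ) ^ (j + l) =
        (q : ℚ) ^ j * ((q : ℚ) ^ n - (q : ℚ) ^ l)),
    Finset.prod_mul_distrib, Finset.prod_const, Finset.card_range, pow_mul, mul_assoc]
  rfl

variable {q : ℕ}

theorem pow_sub_pow_ne_zero (hq : 2 ≤ q) {a i : ℕ} (h : i < a) :
    (q : ℚ) ^ a - (q : ℚ) ^ i ≠ 0 :=
  sub_ne_zero.2 (pow_right_strictMono₀ (by exact_mod_cast hq) h).ne'

theorem frameCount_ne_zero (hq : 2 ≤ q) {a b : ℕ} (h : b ≤ a) : frameCount q a b ≠ 0 :=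
  Finset.prod_ne_zero_iff.2 fun _ hi =>
    pow_sub_pow_ne_zero hq ((Finset.mem_range.1 hi).trans_le h)

theorem gaussBinom_eq_div (hq : 2 ≤ q) (a b : ℕ) :
    gaussBinom q a b = frameCount q a b / frameCount q b b := by
  have hq0 : (q : ℚ) ≠ 0 := by positivity
  have key : ∀ c i : ℕ, i ≤ c →
      (q : ℚ) ^ c - (q : ℚ) ^ i = (q : ℚ) ^ i * ((q : ℚ) ^ (c - i) - 1) := fun c i h => by
    rw [mul_sub, mul_one, ← pow_add, Nat.add_sub_cancel' h]
  rcases lt_or_ge a b with h | h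
  · rw [frameCount_eq_zero h, zero_div]
    exact Finset.prod_eq_zero (Finset.mem_range.2 h) (by simp)
  · rw [gaussBinom, frameCount, frameCount, ← Finset.prod_div_distrib]
    refine Finset.prod_congr rfl fun i hi => ?_
    have hi := Finset.mem_range.1 hi
    rw [key a i (hi.le.trans h), key b i hi.le, mul_div_mul_left _ _ (pow_ne_zero _ hq0)]

theorem gaussBinom_zero (q a : ℕ) : gaussBinom q a 0 = 1 :=
  Finset.prod_range_zero _

theorem gaussBinom_eq_zero {a b : ℕ} (h : a < b) : gaussBinom q a b = 0 :=
  Finset.prod_eq_zero (Finset.mem_range.2 h) (by simp)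

theorem gaussBinom_self (hq : 2 ≤ q) (a : ℕ) : gaussBinom q a a = 1 := by
  rw [gaussBinom_eq_div hq, div_self (frameCount_ne_zero hq le_rfl)]

/-- The `q`-analogue of Pascal's rule. -/
theorem gaussBinom_succ_succ (hq : 2 ≤ q) (n i : ℕ) :
    gaussBinom q (n + 1) (i + 1) =
      (q : ℚ) ^ (i + 1) * gaussBinom q n (i + 1) + gaussBinom q n i := by
  have hq0 : (q : ℚ) ≠ 0 := by positivity
  have h1 : (q : ℚ) ^ (i + 1) - 1 ≠ 0 := by
    simpa using pow_sub_pow_ne_zero hq (Nat.succ_pos i)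
  have h2 := frameCount_ne_zero hq (le_refl i)
  simp only [gaussBinom_eq_div hq]
  rw [frameCount_succ_succ q n i, frameCount_succ_succ q i i, frameCount_succ]
  field_simp
  ring

/-- The `q`-binomial theorem at `-1`. -/
theorem sum_neg_one_pow_gaussBinom (hq : 2 ≤ q) (n : ℕ) :
    ∑ i ∈ Finset.range (n + 1), (-1) ^ i * (q : ℚ) ^ (Nat.choose i 2) * gaussBinom q n i =
      if n = 0 then 1 else 0 := by
  rcases n with _ | n
  · simp [gaussBinom_zero]
  have hc : ∀ i, Nat.choose (i + 1) 2 = Nat.choose i 2 + i := fun i => by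
    rw [Nat.choose_succ_succ' i 1, Nat.choose_one_right, add_comm]
  -- By Pascal's rule the alternating sum telescopes along `u`; the remaining `-u 0 = -1` cancels
  -- the term `i = 0`.
  let u : ℕ → ℚ := fun i => (-1) ^ i * (q : ℚ) ^ (Nat.choose (i + 1) 2) * gaussBinom q n i
  have h : ∀ i ∈ Finset.range (n + 1),
      (-1) ^ (i + 1) * (q : ℚ) ^ (Nat.choose (i + 1) 2) * gaussBinom q (n + 1) (i + 1) =
        u (i + 1) - u i := fun i _ => by
    simp only [u, gaussBinom_succ_succ hq, hc (i + 1)]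
    ring
  rw [Finset.sum_range_succ', Finset.sum_congr rfl h, Finset.sum_range_sub]
  simp [u, gaussBinom_zero, gaussBinom_eq_zero]

/-- Both sides count flags of dimensions `j ≤ j + i` in a `(j + n)`-dimensional space. -/
theorem gaussBinom_mul_gaussBinom (hq : 2 ≤ q) (j n i : ℕ) :
    gaussBinom q (j + n) (j + i) * gaussBinom q (j + i) j =
      gaussBinom q (j + n) j * gaussBinom q n i := by
  have hq0 : (q : ℚ) ≠ 0 := by positivity
  have h1 := frameCount_ne_zero hq (le_refl j)
  have h2 := frameCount_ne_zero hq (le_refl i)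
  have h3 := frameCount_ne_zero hq (Nat.le_add_right j i)
  simp only [gaussBinom_eq_div hq]
  rw [frameCount_add q j n i, frameCount_add q j i i]
  field_simp

theorem gaussBinom_symm (hq : 2 ≤ q) (a b : ℕ) :
    gaussBinom q (a + b) a = gaussBinom q (a + b) b := by
  have hq0 : (q : ℚ) ≠ 0 := by positivity
  have h1 := frameCount_ne_zero hq (le_refl a)
  have h2 := frameCount_ne_zero hq (le_refl b)
  -- Two factorizations of the number of ordered bases in dimension `a + b` are compared.
  have ha := frameCount_add q a b b
  have hb := frameCount_add q b a a
  rw [add_comm b a, ha, mul_comm b a] at hb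
  simp only [gaussBinom_eq_div hq]
  rw [div_eq_div_iff h1 h2]
  have h3 : (q : ℚ) ^ (a * b) ≠ 0 := pow_ne_zero _ hq0
  refine mul_left_cancel₀ h3 ?_
  linear_combination hb

/-- Inversion of Gaussian binomial coefficients. -/
theorem sum_gaussBinom_inversion (hq : 2 ≤ q) {j r u : ℕ} (hu : u ≤ j + r) :
    ∑ i ∈ Finset.range (r + 1), (-1) ^ i * (q : ℚ) ^ (Nat.choose i 2) *
      (gaussBinom q u (j + i) * gaussBinom q (j + i) j) = if u = j then 1 else 0 := by
  rcases lt_or_ge u j with h | h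
  · rw [if_neg h.ne]
    refine Finset.sum_eq_zero fun i _ => ?_
    rw [gaussBinom_eq_zero (by omega : u < j + i), zero_mul, mul_zero]
  obtain ⟨n, rfl⟩ := Nat.exists_eq_add_of_le h
  have hs := sum_neg_one_pow_gaussBinom hq n
  rw [Finset.sum_subset (Finset.range_subset_range.2 (by omega : n + 1 ≤ r + 1))] at hs
  · simp only [gaussBinom_mul_gaussBinom hq]
    have : ∀ i, (-1) ^ i * (q : ℚ) ^ (Nat.choose i 2) *
        (gaussBinom q (j + n) j * gaussBinom q n i) =
        gaussBinom q (j + n) j * ((-1) ^ i * (q : ℚ) ^ (Nat.choose i 2) * gaussBinom q n i) :=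
      fun i => by ring
    simp only [this, ← Finset.mul_sum, hs]
    rcases n with _ | n
    · simp [gaussBinom_self hq]
    · simp
  · intro i _ hi
    rw [gaussBinom_eq_zero (by simpa using hi), mul_zero]

end GaussBinom

/-! ### Rank distribution of linear MRD codes. -/

section RankDistribution

open Module

variable {F : Type*} [Field F]

theorem natCard_linearIndependent_eq_frameCount [Finite F] (V : Type*) [AddCommGroup V]
    [Module F V] [Module.Finite F V] (s : ℕ) :
    (Nat.card {v : Fin s → V // LinearIndependent F v} : ℚ) =
      frameCount (Nat.card F) (finrank F V) s := by
  have := Fintype.ofFinite F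
  have : Finite V := Module.finite_of_finite F
  rcases le_or_gt s (finrank F V) with h | h
  · rw [card_linearIndependent h, frameCount, ← Fin.prod_univ_eq_prod_range
      (fun i => (Nat.card F : ℚ) ^ finrank F V - (Nat.card F : ℚ) ^ i), Nat.cast_prod]
    refine Finset.prod_congr rfl fun i _ => ?_
    rw [Nat.cast_sub (Nat.pow_le_pow_right Fintype.card_pos (i.2.le.trans h)),
      Fintype.card_eq_nat_card]
    push_cast
    rfl
  · have : IsEmpty {v : Fin s → V // LinearIndependent F v} :=
      ⟨fun v => by have := v.2.fintype_card_le_finrank; simp at this; omega⟩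
    rw [frameCount_eq_zero h]
    simp

variable {m n : ℕ}

theorem Matrix.rank_add_finrank_ker_mulVecLin (A : Matrix (Fin m) (Fin n) F) :
    A.rank + finrank F (LinearMap.ker A.mulVecLin) = n := by
  simpa [Matrix.rank] using A.mulVecLin.finrank_range_add_finrank_ker

theorem IsLinearMRD.le_rank {δ : ℕ} {Q : Submodule F (Matrix (Fin m) (Fin n) F)}
    (hQ : IsLinearMRD δ Q) {A : Matrix (Fin m) (Fin n) F} (hA : A ∈ Q) (h0 : A ≠ 0) :
    δ ≤ A.rank := by
  simpa using hQ.1 A hA 0 Q.zero_mem h0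

/-- The evaluation of the matrices in `Q` at the vectors of the family `v`. -/
def evalFamily (Q : Submodule F (Matrix (Fin m) (Fin n) F)) {s : ℕ} (v : Fin s → Fin n → F) :
    Q →ₗ[F] (Fin s → Fin m → F) where
  toFun A i := A.1.mulVec (v i)
  map_add' A B := by ext; simp [Matrix.add_mulVec]
  map_smul' c A := by ext; simp [Matrix.smul_mulVec]

theorem mem_ker_evalFamily {Q : Submodule F (Matrix (Fin m) (Fin n) F)} {s : ℕ}
    {v : Fin s → Fin n → F} {A : Q} :
    A ∈ LinearMap.ker (evalFamily Q v) ↔ ∀ i, A.1.mulVec (v i) = 0 := by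
  rw [LinearMap.mem_ker, funext_iff]
  rfl

variable {δ : ℕ} {Q : Submodule F (Matrix (Fin m) (Fin n) F)}

/-- A codeword killing `n + 1 - δ` independent vectors has rank below `δ`, hence is zero. -/
theorem IsLinearMRD.ker_evalFamily_eq_bot (hQ : IsLinearMRD δ Q) (hδn : δ ≤ n) {s : ℕ}
    {v : Fin s → Fin n → F} (hv : LinearIndependent F v) (hs : n + 1 - δ ≤ s) :
    LinearMap.ker (evalFamily Q v) = ⊥ := by
  refine (Submodule.eq_bot_iff _).2 fun A hA => ?_
  rw [mem_ker_evalFamily] at hA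
  by_contra h0
  have h1 := hQ.le_rank A.2 (by simpa using h0)
  have h2 : Submodule.span F (Set.range v) ≤ LinearMap.ker A.1.mulVecLin := by
    rw [Submodule.span_le]
    rintro _ ⟨i, rfl⟩
    exact hA i
  have h3 := Submodule.finrank_mono h2
  rw [finrank_span_eq_card hv, Fintype.card_fin] at h3
  have h4 := A.1.rank_add_finrank_ker_mulVecLin
  omega

theorem rankCount_eq_card_filter [Fintype Q] (r : ℕ) :
    rankCount Q r = (Finset.univ.filter fun A : Q => A.1.rank = r).card := by
  rw [rankCount, ← Set.ncard_coe_finset, ← Set.ncard_image_of_injective _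
    (Subtype.val_injective : Function.Injective (Subtype.val : Q → _))]
  congr 1
  ext A
  simp [and_comm]

theorem IsLinearMRD.natCard_rank_le [Finite Q] (hQ : IsLinearMRD δ Q) (hδ : 1 ≤ δ) (c : ℕ) :
    Nat.card {A : Q // A.1.rank ≤ c} = 1 + ∑ r ∈ Finset.Icc δ c, rankCount Q r := by
  classical
  have := Fintype.ofFinite Q
  have h : (Finset.univ.filter fun A : Q => A.1.rank ≤ c) =
      insert 0 (Finset.univ.filter fun A : Q => A.1.rank ∈ Finset.Icc δ c) := by
    ext A
    simp only [Finset.mem_filter, Finset.mem_univ, true_and, Finset.mem_insert, Finset.mem_Icc]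
    rcases eq_or_ne A 0 with rfl | hA
    · simp
    · have := hQ.le_rank A.2 (by simpa using hA)
      tauto
  have h0 : (0 : Q) ∉ Finset.univ.filter fun A : Q => A.1.rank ∈ Finset.Icc δ c := by
    simp
    omega
  have hmaps : Set.MapsTo (fun A : Q => A.1.rank)
      (Finset.univ.filter fun A : Q => A.1.rank ∈ Finset.Icc δ c) (Finset.Icc δ c) :=
    fun A hA => (Finset.mem_filter.1 hA).2
  rw [Nat.card_eq_fintype_card, Fintype.card_subtype, h, Finset.card_insert_of_notMem h0,
    add_comm, Finset.card_eq_sum_card_fiberwise hmaps]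
  congr 1
  refine Finset.sum_congr rfl fun r hr => ?_
  rw [rankCount_eq_card_filter, Finset.filter_filter]
  congr 1
  ext A
  simp only [Finset.mem_filter, Finset.mem_univ, true_and]
  exact ⟨fun h => h.2, fun h => ⟨h ▸ hr, h⟩⟩

variable [Finite F]

theorem IsLinearMRD.finrank_eq (hQ : IsLinearMRD δ Q) (hnm : n ≤ m) :
    finrank F Q = m * (n + 1 - δ) := by
  have h := hQ.2
  rw [Module.natCard_eq_pow_finrank (K := F), max_eq_left hnm, min_eq_right hnm] at h
  exact Nat.pow_right_injective Finite.one_lt_card h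

/-- At length `n + 1 - δ` evaluation is injective between spaces of equal dimension. Shorter
families are extended to that length. -/
theorem IsLinearMRD.range_evalFamily_eq_top (hQ : IsLinearMRD δ Q) (hδn : δ ≤ n) (hδ : 1 ≤ δ)
    (hnm : n ≤ m) {s c : ℕ} {v : Fin s → Fin n → F} (hv : LinearIndependent F v)
    (hs : s + c = n + 1 - δ) : LinearMap.range (evalFamily Q v) = ⊤ := by
  induction c generalizing s with
  | zero =>
    have h1 := (evalFamily Q v).finrank_range_add_finrank_ker
    rw [hQ.ker_evalFamily_eq_bot hδn hv (by omega), finrank_bot, hQ.finrank_eq hnm] at h1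
    refine Submodule.eq_top_of_finrank_eq ?_
    rw [← add_zero (finrank F _), h1, ← hs]
    simp [finrank_pi_fintype, mul_comm]
  | succ c ih =>
    obtain ⟨x, hx⟩ := exists_linearIndependent_snoc_of_lt_finrank hv
      (by rw [finrank_fin_fun]; omega)
    have h := ih hx (by omega)
    rw [LinearMap.range_eq_top] at h ⊢
    intro y
    obtain ⟨A, hA⟩ := h (Fin.snoc (α := fun _ => Fin m → F) y 0)
    refine ⟨A, funext fun i => ?_⟩
    have := congr_fun hA i.castSucc
    simpa [evalFamily] using this

theorem IsLinearMRD.finrank_ker_evalFamily (hQ : IsLinearMRD δ Q) (hδn : δ ≤ n) (hδ : 1 ≤ δ)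
    (hnm : n ≤ m) {s : ℕ} {v : Fin s → Fin n → F} (hv : LinearIndependent F v) :
    finrank F (LinearMap.ker (evalFamily Q v)) = m * (n + 1 - δ - s) := by
  rcases le_total (n + 1 - δ) s with h | h
  · rw [hQ.ker_evalFamily_eq_bot hδn hv h, finrank_bot, Nat.sub_eq_zero_of_le h, mul_zero]
  · obtain ⟨c, hc⟩ := Nat.exists_eq_add_of_le h
    have h1 := (evalFamily Q v).finrank_range_add_finrank_ker
    rw [hQ.range_evalFamily_eq_top hδn hδ hnm hv hc.symm, hQ.finrank_eq hnm, finrank_top,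
      finrank_pi_fintype] at h1
    simp only [finrank_fin_fun, Finset.sum_const, Finset.card_univ, Fintype.card_fin,
      smul_eq_mul] at h1
    rw [Nat.mul_sub, ← h1, mul_comm m s, Nat.add_sub_cancel_left]

/-- Linearly independent families in the kernel of `A`, as families in the ambient space. -/
def kerFamilyEquiv (Q : Submodule F (Matrix (Fin m) (Fin n) F)) (s : ℕ) (A : Q) :
    {v : Fin s → LinearMap.ker A.1.mulVecLin // LinearIndependent F v} ≃
      {v : {v : Fin s → Fin n → F // LinearIndependent F v} //
        A ∈ LinearMap.ker (evalFamily Q v.1)} where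
  toFun v := ⟨⟨fun i => v.1 i, v.2.map' (Submodule.subtype _) (Submodule.ker_subtype _)⟩,
    mem_ker_evalFamily.2 fun i => (v.1 i).2⟩
  invFun v := ⟨fun i => ⟨v.1.1 i, mem_ker_evalFamily.1 v.2 i⟩,
    LinearIndependent.of_comp (Submodule.subtype _) v.1.2⟩
  left_inv _ := rfl
  right_inv _ := rfl

/-- Double counting of pairs `(A, v)` with `v` an independent `s`-tuple in `ker A`: the codewords
killing `v` form a space whose dimension depends only on `s`. -/
theorem IsLinearMRD.sum_frameCount [Fintype Q] (hQ : IsLinearMRD δ Q) (hδn : δ ≤ n)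
    (hδ : 1 ≤ δ) (hnm : n ≤ m) (s : ℕ) :
    ∑ A : Q, frameCount (Nat.card F) (n - A.1.rank) s =
      frameCount (Nat.card F) n s * (Nat.card F : ℚ) ^ (m * (n + 1 - δ - s)) := by
  have := Fintype.ofFinite {v : Fin s → Fin n → F // LinearIndependent F v}
  have e : (Σ A : Q, {v : Fin s → LinearMap.ker A.1.mulVecLin // LinearIndependent F v}) ≃
      Σ v : {v : Fin s → Fin n → F // LinearIndependent F v},
        LinearMap.ker (evalFamily Q v.1) :=
    (Equiv.sigmaCongrRight fun A => kerFamilyEquiv Q s A).trans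
      { toFun x := ⟨x.2.1, x.1, x.2.2⟩
        invFun x := ⟨x.2.1, x.1, x.2.2⟩
        left_inv _ := rfl
        right_inv _ := rfl }
  have h := Nat.card_congr e
  rw [Nat.card_sigma, Nat.card_sigma] at h
  have h1 : ∀ v : {v : Fin s → Fin n → F // LinearIndependent F v},
      Nat.card (LinearMap.ker (evalFamily Q v.1)) =
        Nat.card F ^ (m * (n + 1 - δ - s)) := fun v => by
    rw [Module.natCard_eq_pow_finrank (K := F), hQ.finrank_ker_evalFamily hδn hδ hnm v.2]
  rw [Finset.sum_congr rfl fun v _ => h1 v, Finset.sum_const, Finset.card_univ,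
    smul_eq_mul, Fintype.card_eq_nat_card] at h
  have h2 := congrArg (Nat.cast : ℕ → ℚ) h
  rw [Nat.cast_sum, Nat.cast_mul, natCard_linearIndependent_eq_frameCount, finrank_fin_fun,
    Nat.cast_pow] at h2
  rw [← h2]
  refine Finset.sum_congr rfl fun A _ => ?_
  rw [natCard_linearIndependent_eq_frameCount,
    ← Nat.eq_sub_of_add_eq' A.1.rank_add_finrank_ker_mulVecLin]

theorem IsLinearMRD.sum_gaussBinom [Fintype Q] (hQ : IsLinearMRD δ Q) (hδn : δ ≤ n)
    (hδ : 1 ≤ δ) (hnm : n ≤ m) (s : ℕ) :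
    ∑ A : Q, gaussBinom (Nat.card F) (n - A.1.rank) s =
      gaussBinom (Nat.card F) n s * (Nat.card F : ℚ) ^ (m * (n + 1 - δ - s)) := by
  have hq : 2 ≤ Nat.card F := Finite.one_lt_card
  simp only [gaussBinom_eq_div hq]
  rw [← Finset.sum_div, hQ.sum_frameCount hδn hδ hnm, div_mul_eq_mul_div]

/-- Delsarte's rank distribution of MRD codes. -/
theorem IsLinearMRD.rankCount_eq (hQ : IsLinearMRD δ Q) (hδ : 1 ≤ δ) (hnm : n ≤ m) {r : ℕ}
    (hδr : δ ≤ r) (hrn : r ≤ n) :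
    (rankCount Q r : ℚ) = delsarteCount (Nat.card F) m n δ r := by
  classical
  have hq : 2 ≤ Nat.card F := Finite.one_lt_card
  have := Fintype.ofFinite Q
  set q := Nat.card F with hqdef
  have hq0 : (q : ℚ) ≠ 0 := by positivity
  obtain ⟨j, rfl⟩ := Nat.exists_eq_add_of_le' hrn
  -- Inversion with `u = dim ker A` and `j = n - r` isolates the codewords of rank `r`.
  have hrank : ∀ A : Q, (if A.1.rank = r then (1 : ℚ) else 0) =
      ∑ i ∈ Finset.range (r + 1), (-1) ^ i * (q : ℚ) ^ (Nat.choose i 2) *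
        (gaussBinom q (j + r - A.1.rank) (j + i) * gaussBinom q (j + i) j) := fun A => by
    rw [sum_gaussBinom_inversion hq (Nat.sub_le _ _)]
    have := A.1.rank_le_width
    congr 1
    exact propext (by omega)
  have hsum : (rankCount Q r : ℚ) = gaussBinom q (j + r) r *
      ∑ i ∈ Finset.range (r + 1), (-1) ^ i * (q : ℚ) ^ (Nat.choose i 2) * gaussBinom q r i *
        (q : ℚ) ^ (m * (j + r + 1 - δ - (j + i))) := by
    rw [rankCount_eq_card_filter, Finset.card_filter, Nat.cast_sum]
    simp only [Nat.cast_ite, Nat.cast_one, Nat.cast_zero]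
    rw [Finset.sum_congr rfl fun A _ => hrank A, Finset.sum_comm, Finset.mul_sum]
    refine Finset.sum_congr rfl fun i _ => ?_
    rw [← Finset.mul_sum, ← Finset.sum_mul, hQ.sum_gaussBinom (by omega) hδ hnm, ← hqdef]
    linear_combination ((-1) ^ i * (q : ℚ) ^ (Nat.choose i 2) *
      (q : ℚ) ^ (m * (j + r + 1 - δ - (j + i)))) * (gaussBinom_mul_gaussBinom hq j r i +
        gaussBinom q r i * gaussBinom_symm hq j r)
  -- Subtracting this vanishing sum (`r ≥ δ ≥ 1`) produces the `-1` in Delsarte's formula and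
  -- cancels the terms with `i > r - δ`, whose power of `q` is `1`.
  have hzero := sum_neg_one_pow_gaussBinom hq r
  rw [if_neg (by omega)] at hzero
  rw [hsum, delsarteCount, ← sub_zero (∑ i ∈ Finset.range (r + 1), _), ← hzero,
    ← Finset.sum_sub_distrib]
  congr 1
  rw [← Finset.sum_subset (Finset.range_subset_range.2 (by omega : r - δ + 1 ≤ r + 1))]
  · refine Finset.sum_congr rfl fun i hi => ?_
    have hi := Finset.mem_range.1 hi
    have h1 : m * (j + r - δ + 1) = m * (j + r + 1 - δ - (j + i)) + m * (j + r + i - r) := by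
      rw [← mul_add]
      congr 1
      omega
    rw [h1, pow_add, mul_div_cancel_right₀ _ (pow_ne_zero _ hq0)]
    ring
  · intro i _ hi
    have hi : ¬ i < r - δ + 1 := by simpa using hi
    rw [(by omega : j + r + 1 - δ - (j + i) = 0), mul_zero, pow_zero, mul_one, sub_self]

end RankDistribution

/-! ### Existence of MRD codes via linearized polynomials. -/

section Gabidulin

open Module Polynomial

variable {F : Type*} [Field F] {K : Type*} [Field K] [Algebra F K]

/-- The `F`-linear map `x ↦ ∑ i, a i * x ^ (q ^ i)` given by a linearized polynomial, depending
linearly on the coefficients; `φ` is the Frobenius automorphism `x ↦ x ^ q`. -/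
noncomputable def linearizedMap (φ : K ≃ₐ[F] K) (c : ℕ) : (Fin c → K) →ₗ[F] (K →ₗ[F] K) :=
  ∑ i : Fin c, (LinearMap.llcomp F K K K).flip ((φ ^ (i : ℕ)).toLinearMap) ∘ₗ
    LinearMap.mul F K ∘ₗ LinearMap.proj i

theorem linearizedMap_apply (φ : K ≃ₐ[F] K) (c : ℕ) (a : Fin c → K) (x : K) :
    linearizedMap φ c a x = ∑ i : Fin c, a i * (φ ^ (i : ℕ)) x := by
  simp [linearizedMap]

/-- The kernel consists of roots of a nonzero polynomial of degree at most `q ^ (c - 1)`, so it has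
at most that many elements. -/
theorem finrank_ker_linearizedMap_lt [Finite F] [Finite K] {φ : K ≃ₐ[F] K}
    (hφ : ∀ (i : ℕ) (x : K), (φ ^ i) x = x ^ (Nat.card F ^ i)) {c : ℕ} {a : Fin c → K}
    (ha : a ≠ 0) : finrank F (LinearMap.ker (linearizedMap φ c a)) < c := by
  classical
  have hq : 1 < Nat.card F := Finite.one_lt_card
  have := Fintype.ofFinite K
  have hc : 0 < c := by
    rcases Nat.eq_zero_or_pos c with rfl | h
    · exact absurd (Subsingleton.elim _ _) ha
    · exact h
  set P : K[X] := ∑ i : Fin c, C (a i) * X ^ (Nat.card F ^ (i : ℕ)) with hP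
  have hcoeff : ∀ j : Fin c, P.coeff (Nat.card F ^ (j : ℕ)) = a j := fun j => by
    simp only [hP, finsetSum_coeff, coeff_C_mul, coeff_X_pow,
      (Nat.pow_right_injective hq).eq_iff, Fin.val_inj]
    simp
  have hP0 : P ≠ 0 := fun h => ha (funext fun j => by rw [← hcoeff j, h]; simp)
  have hdeg : P.natDegree ≤ Nat.card F ^ (c - 1) :=
    natDegree_sum_le_of_forall_le _ _ fun i _ =>
      (natDegree_C_mul_X_pow_le _ _).trans
        (Nat.pow_le_pow_right hq.le (by have := i.2; omega))
  have hroots : Nat.card (LinearMap.ker (linearizedMap φ c a)) ≤ P.roots.toFinset.card := by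
    rw [← Nat.card_eq_finsetCard]
    suffices hmem : ∀ x : LinearMap.ker (linearizedMap φ c a), x.1 ∈ P.roots.toFinset from
      Nat.card_le_card_of_injective (fun x => (⟨x.1, hmem x⟩ : P.roots.toFinset))
        fun x y h => Subtype.ext (congrArg (fun z : P.roots.toFinset => z.1) h)
    intro x
    have hx := linearizedMap_apply φ c a x.1
    rw [LinearMap.mem_ker.1 x.2] at hx
    rw [Multiset.mem_toFinset, mem_roots hP0, IsRoot.def, hP, eval_finsetSum, hx]
    simp [hφ]
  have h := (hroots.trans (Multiset.toFinset_card_le _)).trans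
    ((card_roots' P).trans hdeg)
  rw [Module.natCard_eq_pow_finrank (K := F), Nat.pow_le_pow_iff_right hq] at h
  omega

/-- Gabidulin codes: linear MRD codes exist. -/
theorem exists_isLinearMRD (F : Type*) [Field F] [Finite F] {m n δ : ℕ} (hδ : 1 ≤ δ)
    (hδn : δ ≤ n) (hnm : n ≤ m) :
    ∃ Q : Submodule F (Matrix (Fin m) (Fin n) F), IsLinearMRD δ Q := by
  obtain ⟨p, _⟩ := CharP.exists F
  have : Fact p.Prime := ⟨CharP.char_is_prime F p⟩
  have : NeZero m := ⟨by omega⟩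
  let K := FiniteField.Extension F p m
  have hK : finrank F K = m := FiniteField.finrank_extension F p m
  let b : K ≃ₗ[F] (Fin m → F) := LinearEquiv.ofFinrankEq _ _ (by rw [hK, finrank_fin_fun])
  obtain ⟨ι, hι⟩ : ∃ ι : (Fin n → F) →ₗ[F] K, Function.Injective ι := by
    obtain ⟨v, hv⟩ := exists_linearIndependent_of_le_finrank (R := F) (M := K) (hnm.trans hK.ge)
    exact ⟨Fintype.linearCombination F v,
      linearIndependent_iff_injective_fintypeLinearCombination.1 hv⟩
  let φ : K ≃ₐ[F] K := FiniteField.Extension.frob F p m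
  let G : (Fin (n + 1 - δ) → K) →ₗ[F] Matrix (Fin m) (Fin n) F :=
    LinearMap.toMatrix'.toLinearMap ∘ₗ
      LinearMap.lcomp F (Fin m → F) ι ∘ₗ LinearMap.llcomp F K K (Fin m → F) b.toLinearMap ∘ₗ
        linearizedMap φ (n + 1 - δ)
  have hG : ∀ a, (G a).mulVecLin = b.toLinearMap ∘ₗ linearizedMap φ (n + 1 - δ) a ∘ₗ ι :=
    fun a => Matrix.toLin'_toMatrix' _
  have hrank : ∀ a, a ≠ 0 → δ ≤ (G a).rank := fun a ha => by
    have h1 := finrank_ker_linearizedMap_lt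
      (fun i x => FiniteField.Extension.frob_iterate_apply F p m i) ha
    have h2 : finrank F (LinearMap.ker (G a).mulVecLin) ≤
        finrank F (LinearMap.ker (linearizedMap φ (n + 1 - δ) a)) := by
      rw [(Submodule.equivMapOfInjective ι hι _).finrank_eq]
      refine Submodule.finrank_mono ?_
      rintro _ ⟨x, hx, rfl⟩
      have hx : (G a).mulVecLin x = 0 := hx
      rw [hG] at hx
      simpa using hx
    have h3 := (G a).rank_add_finrank_ker_mulVecLin
    have h4 : finrank F (LinearMap.ker (linearizedMap φ (n + 1 - δ) a)) < n + 1 - δ := h1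
    omega
  have hinj : Function.Injective G := by
    rw [← LinearMap.ker_eq_bot, Submodule.eq_bot_iff]
    intro a ha
    by_contra h0
    have := hrank a h0
    rw [LinearMap.mem_ker.1 ha, Matrix.rank_zero] at this
    omega
  refine ⟨LinearMap.range G, ?_, ?_⟩
  · rintro _ ⟨a, rfl⟩ _ ⟨a', rfl⟩ h
    rw [← map_sub]
    exact hrank _ (sub_ne_zero.2 fun h' => h (by rw [h']))
  · rw [← Nat.card_congr (LinearEquiv.ofInjective G hinj).toEquiv, Nat.card_fun,
      Nat.card_fin, FiniteField.natCard_extension, max_eq_left hnm, min_eq_right hnm, ← pow_mul]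

end Gabidulin

/-! ### Intersections of parametrized subspaces and the linkage construction. -/

section Codes

open Module

variable {F : Type*} [Field F] {X E A B : Type*} [AddCommGroup X] [Module F X]
  [AddCommGroup E] [Module F E] [AddCommGroup A] [Module F A]
  [AddCommGroup B] [Module F B]

theorem finrank_range_inf_le_of_injective [Module.Finite F B] (p : E →ₗ[F] B) {g h : X →ₗ[F] E}
    (hg : Function.Injective (p ∘ₗ g)) :
    finrank F ↥(LinearMap.range g ⊓ LinearMap.range h) ≤
      finrank F ↥(LinearMap.range (p ∘ₗ g) ⊓ LinearMap.range (p ∘ₗ h)) := by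
  let f : ↥(LinearMap.range g ⊓ LinearMap.range h) →ₗ[F]
      ↥(LinearMap.range (p ∘ₗ g) ⊓ LinearMap.range (p ∘ₗ h)) :=
    (p.domRestrict _).codRestrict _ <| by
      rintro ⟨_, ⟨x, rfl⟩, ⟨y, hy⟩⟩
      exact ⟨⟨x, rfl⟩, ⟨y, by simp [hy]⟩⟩
  refine LinearMap.finrank_le_finrank_of_injective (f := f) ?_
  rintro ⟨_, ⟨x, rfl⟩, hx⟩ ⟨_, ⟨y, rfl⟩, hy⟩ hxy
  have h1 : p (g x) = p (g y) := congrArg Subtype.val hxy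
  have h2 : x = y := hg h1
  subst h2
  rfl

/-- If `g x = h y`, applying `p` forces `x = y`, so the intersection lies in the image under `g` of
`ker (g - h)`. -/
theorem finrank_range_inf_le_of_comp_eq [Module.Finite F X] (p : E →ₗ[F] B) {g h : X →ₗ[F] E}
    (hg : Function.Injective (p ∘ₗ g)) (hgh : p ∘ₗ g = p ∘ₗ h) :
    finrank F ↥(LinearMap.range g ⊓ LinearMap.range h) ≤
      finrank F ↥(LinearMap.ker (g - h)) := by
  refine le_trans (Submodule.finrank_mono ?_) (Submodule.finrank_map_le g _)
  rintro _ ⟨⟨x, rfl⟩, ⟨y, hy⟩⟩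
  have h1 : (p ∘ₗ g) y = (p ∘ₗ g) x := by
    rw [hgh, LinearMap.comp_apply, hy, ← LinearMap.comp_apply, hgh]
  have h2 : y = x := hg h1
  subst h2
  exact ⟨y, by simp [hy], rfl⟩

theorem finrank_range_inf_le_of_proj [Module.Finite F X] [Module.Finite F B] (p : E →ₗ[F] B)
    (s : E →ₗ[F] A) {g h : X →ₗ[F] E} {c : ℕ} (hg : Function.Injective (p ∘ₗ g))
    (hne : p ∘ₗ g ≠ p ∘ₗ h →
      finrank F ↥(LinearMap.range (p ∘ₗ g) ⊓ LinearMap.range (p ∘ₗ h)) ≤ c)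
    (heq : p ∘ₗ g = p ∘ₗ h → finrank F ↥(LinearMap.ker (s ∘ₗ g - s ∘ₗ h)) ≤ c) :
    finrank F ↥(LinearMap.range g ⊓ LinearMap.range h) ≤ c := by
  by_cases hgh : p ∘ₗ g = p ∘ₗ h
  · refine (finrank_range_inf_le_of_comp_eq p hg hgh).trans
      ((Submodule.finrank_mono ?_).trans (heq hgh))
    rw [← LinearMap.comp_sub]
    exact LinearMap.ker_le_ker_comp _ _
  · exact (finrank_range_inf_le_of_injective p hg).trans (hne hgh)

/-- For `k`-spaces the distance equals `2 * k - 2 * dim (U ∩ W)`. -/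
theorem le_subspaceDist_iff {n k δ : ℕ} (hδk : δ ≤ k) {U W : Submodule F (Fin n → F)}
    (hU : finrank F U = k) (hW : finrank F W = k) :
    δ + δ ≤ subspaceDist U W ↔ finrank F ↥(U ⊓ W) ≤ k - δ := by
  have h1 := Submodule.finrank_sup_add_finrank_inf_eq U W
  have h2 := Submodule.finrank_mono (inf_le_left : U ⊓ W ≤ U)
  rw [subspaceDist]
  omega

/-- A maximum constant dimension code, presented by injective linear maps. -/
theorem exists_family_card_eq_maxCodeSize (F : Type*) [Field F] [Finite F] {n k δ : ℕ}
    (hδk : δ ≤ k) :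
    ∃ (C : Set (Submodule F (Fin n → F))) (φ : C → (Fin k → F) →ₗ[F] (Fin n → F)),
      Nat.card C = maxCodeSize F n k (δ + δ) ∧ Function.Injective φ ∧
      (∀ U, Function.Injective (φ U)) ∧
      ∀ U W, U ≠ W → finrank F ↥(LinearMap.range (φ U) ⊓ LinearMap.range (φ W)) ≤ k - δ := by
  obtain ⟨⟨C, ⟨hk, hd⟩, hC⟩, -⟩ := maxCodeSize_isGreatest F n k (δ + δ)
  let e : ∀ U : C, (Fin k → F) ≃ₗ[F] U.1 := fun U =>
    LinearEquiv.ofFinrankEq _ _ (by rw [finrank_fin_fun, hk U.1 U.2])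
  have hr : ∀ U : C, LinearMap.range (U.1.subtype ∘ₗ (e U).toLinearMap) = U.1 := fun U => by
    rw [LinearMap.range_comp, LinearEquiv.range, Submodule.map_top, Submodule.range_subtype]
  refine ⟨C, fun U => U.1.subtype ∘ₗ (e U).toLinearMap, hC, fun U W h => ?_, fun U => ?_,
    fun U W h => ?_⟩
  · rw [Subtype.ext_iff, ← hr U, ← hr W]
    exact congrArg _ h
  · exact Subtype.val_injective.comp (e U).injective
  · rw [hr, hr, ← le_subspaceDist_iff hδk (hk U.1 U.2) (hk W.1 W.2)]
    exact hd U.1 U.2 W.1 W.2 fun h' => h (Subtype.ext h')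

theorem natCard_le_maxCodeSize [Finite F] [Module.Finite F E] {N k δ : ℕ}
    (hE : finrank F E = N) (hδ : 1 ≤ δ) (hδk : δ ≤ k)
    {ι : Type*} (g : ι → (Fin k → F) →ₗ[F] E) (hg : ∀ i, Function.Injective (g i))
    (hd : ∀ i j, i ≠ j →
      finrank F ↥(LinearMap.range (g i) ⊓ LinearMap.range (g j)) ≤ k - δ) :
    Nat.card ι ≤ maxCodeSize F N k (δ + δ) := by
  let e : E ≃ₗ[F] (Fin N → F) := LinearEquiv.ofFinrankEq _ _ (by rw [hE, finrank_fin_fun])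
  let S : ι → Submodule F (Fin N → F) := fun i => (LinearMap.range (g i)).map e.toLinearMap
  have hS : ∀ i, finrank F (S i) = k := fun i => by
    rw [LinearEquiv.finrank_map_eq e, LinearMap.finrank_range_of_inj (hg i), finrank_fin_fun]
  have hinf : ∀ i j, i ≠ j → finrank F ↥(S i ⊓ S j) ≤ k - δ := fun i j hij => by
    rw [← Submodule.map_inf _ e.injective, LinearEquiv.finrank_map_eq e]
    exact hd i j hij
  -- A repeated space would meet itself in dimension `k > k - δ`, so indices count codewords.
  have hinj : Function.Injective S := fun i j hij => by
    by_contra h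
    have := hinf i j h
    rw [← hij, inf_idem, hS] at this
    omega
  refine (maxCodeSize_isGreatest F N k (δ + δ)).2 ⟨Set.range S, ⟨?_, ?_⟩, ?_⟩
  · rintro _ ⟨i, rfl⟩
    exact hS i
  · rintro _ ⟨i, rfl⟩ _ ⟨j, rfl⟩ h
    exact (le_subspaceDist_iff hδk (hS i) (hS j)).2 (hinf i j fun h' => h (congrArg S h'))
  · rw [← Set.image_univ, Set.ncard_image_of_injective _ hinj, Set.ncard_univ]

/-- Two compatible splittings of an `(n₁ + n₂)`-dimensional space. -/
theorem exists_linearEquiv_shift (F : Type*) [Field F] {n₁ n₂ t : ℕ} (ht : t ≤ n₁) :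
    ∃ (ε : ((Fin n₁ → F) × (Fin n₂ → F)) ≃ₗ[F] ((Fin (n₁ - t) → F) × (Fin (n₂ + t) → F)))
      (π : (Fin (n₂ + t) → F) →ₗ[F] (Fin n₂ → F)), ∀ x, π (ε x).2 = x.2 := by
  -- A `t`-dimensional block is split off `F ^ n₁` and merged with `F ^ n₂`; `π` forgets it.
  let e₁ : (Fin n₁ → F) ≃ₗ[F] (Fin (n₁ - t) → F) × (Fin t → F) :=
    LinearEquiv.ofFinrankEq _ _ (by simp; omega)
  let e₂ : ((Fin t → F) × (Fin n₂ → F)) ≃ₗ[F] (Fin (n₂ + t) → F) :=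
    LinearEquiv.ofFinrankEq _ _ (by simp; omega)
  refine ⟨((e₁.prodCongr (.refl F _)).trans (LinearEquiv.prodAssoc F _ _ _)).trans
    (LinearEquiv.prodCongr (.refl F _) e₂), LinearMap.snd F _ _ ∘ₗ e₂.symm.toLinearMap,
    fun x => ?_⟩
  simp

theorem IsLinearMRD.finrank_ker_sub_le {m k δ : ℕ}
    {Q : Submodule F (Matrix (Fin m) (Fin k) F)} (hQ : IsLinearMRD δ Q) {M M' : Q}
    (h : M ≠ M') : finrank F (LinearMap.ker (M.1.mulVecLin - M'.1.mulVecLin)) ≤ k - δ := by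
  have h1 := hQ.1 M.1 M.2 M'.1 M'.2 fun h' => h (Subtype.ext h')
  have h2 := (M.1 - M'.1).rank_add_finrank_ker_mulVecLin
  have h3 : (M.1 - M'.1).mulVecLin = M.1.mulVecLin - M'.1.mulVecLin := by
    ext
    simp
  rw [h3] at h2
  omega

/-- The generalized linkage construction. -/
theorem IsLinearMRD.linkage_le_maxCodeSize [Finite F] {k δ n₁ n₂ t : ℕ} (hδ : 1 ≤ δ) (hδk : δ ≤ k)
    (ht : t ≤ n₁) {Q₁ : Submodule F (Matrix (Fin n₁) (Fin k) F)}
    {Q₂ : Submodule F (Matrix (Fin (n₂ + t)) (Fin k) F)} (hQ₁ : IsLinearMRD δ Q₁)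
    (hQ₂ : IsLinearMRD δ Q₂) :
    Nat.card Q₁ * maxCodeSize F n₂ k (δ + δ) +
        maxCodeSize F (n₁ - t) k (δ + δ) * Nat.card {M : Q₂ // M.1.rank ≤ k - δ} ≤
      maxCodeSize F (n₁ + n₂) k (δ + δ) := by
  obtain ⟨C₂, φ, hcard₂, hφ', hφ, hφd⟩ :=
    exists_family_card_eq_maxCodeSize F (n := n₂) hδk
  obtain ⟨C₁, ψ, hcard₁, hψ', hψ, hψd⟩ :=
    exists_family_card_eq_maxCodeSize F (n := n₁ - t) hδk
  obtain ⟨ε, π, hπ⟩ := exists_linearEquiv_shift F (n₂ := n₂) ht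
  let g₁ : Q₁ × C₂ → (Fin k → F) →ₗ[F] (Fin n₁ → F) × (Fin n₂ → F) := fun i =>
    i.1.1.mulVecLin.prod (φ i.2)
  let g₂ : C₁ × {M : Q₂ // M.1.rank ≤ k - δ} →
      (Fin k → F) →ₗ[F] (Fin n₁ → F) × (Fin n₂ → F) := fun i =>
    ε.symm.toLinearMap ∘ₗ (ψ i.1).prod i.2.1.1.mulVecLin
  let p₁ : (Fin n₁ → F) × (Fin n₂ → F) →ₗ[F] (Fin n₂ → F) := LinearMap.snd F _ _
  let s₁ : (Fin n₁ → F) × (Fin n₂ → F) →ₗ[F] (Fin n₁ → F) := LinearMap.fst F _ _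
  let p₂ : (Fin n₁ → F) × (Fin n₂ → F) →ₗ[F] (Fin (n₁ - t) → F) :=
    LinearMap.fst F _ _ ∘ₗ ε.toLinearMap
  let s₂ : (Fin n₁ → F) × (Fin n₂ → F) →ₗ[F] (Fin (n₂ + t) → F) :=
    LinearMap.snd F _ _ ∘ₗ ε.toLinearMap
  have hp₁ : ∀ i, p₁ ∘ₗ g₁ i = φ i.2 := fun i => LinearMap.snd_prod _ _
  have hs₁ : ∀ i, s₁ ∘ₗ g₁ i = i.1.1.mulVecLin := fun i => LinearMap.fst_prod _ _
  have hp₂ : ∀ i, p₂ ∘ₗ g₂ i = ψ i.1 := fun i => by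
    refine LinearMap.ext fun x => ?_
    simp [p₂, g₂]
  have hs₂ : ∀ i, s₂ ∘ₗ g₂ i = i.2.1.1.mulVecLin := fun i => by
    refine LinearMap.ext fun x => ?_
    simp [s₂, g₂]
  have hp₁₂ : ∀ i, p₁ ∘ₗ g₂ i = π ∘ₗ i.2.1.1.mulVecLin := fun i => by
    rw [← hs₂ i]
    refine LinearMap.ext fun x => ?_
    exact (hπ (g₂ i x)).symm
  have hinj₁ : ∀ i, Function.Injective (p₁ ∘ₗ g₁ i) := fun i => by
    rw [hp₁]
    exact hφ _
  have hinj₂ : ∀ i, Function.Injective (p₂ ∘ₗ g₂ i) := fun i => by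
    rw [hp₂]
    exact hψ _
  have h₁ : ∀ i j, i ≠ j →
      finrank F ↥(LinearMap.range (g₁ i) ⊓ LinearMap.range (g₁ j)) ≤ k - δ := by
    intro i j hij
    refine finrank_range_inf_le_of_proj p₁ s₁ (hinj₁ i) ?_ ?_
    · rw [hp₁, hp₁]
      exact fun h => hφd _ _ fun h' => h (congrArg φ h')
    · rw [hp₁, hp₁, hs₁, hs₁]
      exact fun h => hQ₁.finrank_ker_sub_le fun h' => hij (Prod.ext h' (hφ' h))
  have h₂ : ∀ i j, i ≠ j →
      finrank F ↥(LinearMap.range (g₂ i) ⊓ LinearMap.range (g₂ j)) ≤ k - δ := by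
    intro i j hij
    refine finrank_range_inf_le_of_proj p₂ s₂ (hinj₂ i) ?_ ?_
    · rw [hp₂, hp₂]
      exact fun h => hψd _ _ fun h' => h (congrArg ψ h')
    · rw [hp₂, hp₂, hs₂, hs₂]
      exact fun h => hQ₂.finrank_ker_sub_le fun h' =>
        hij (Prod.ext (hψ' h) (Subtype.ext h'))
  -- The only place where the rank restriction on `Q₂` enters: the projection of the second space to
  -- `F ^ n₂` is the image under `π` of the range of a matrix of rank at most `k - δ`.
  have h₁₂ : ∀ i j,
      finrank F ↥(LinearMap.range (g₁ i) ⊓ LinearMap.range (g₂ j)) ≤ k - δ := by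
    intro i j
    refine (finrank_range_inf_le_of_injective p₁ (hinj₁ i)).trans
      ((Submodule.finrank_mono inf_le_right).trans ?_)
    rw [hp₁₂, LinearMap.range_comp]
    exact (Submodule.finrank_map_le _ _).trans j.2.2
  have hN : finrank F ((Fin n₁ → F) × (Fin n₂ → F)) = n₁ + n₂ := by simp
  have hcode := natCard_le_maxCodeSize hN hδ hδk (Sum.elim g₁ g₂) ?_ ?_
  · rwa [Nat.card_sum, Nat.card_prod, Nat.card_prod, hcard₁, hcard₂] at hcode
  · rintro (i | i)
    · exact Function.Injective.of_comp (f := p₁) (hinj₁ i)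
    · exact Function.Injective.of_comp (f := p₂) (hinj₂ i)
  · rintro (i | i) (j | j) hij
    · exact h₁ i j fun h => hij (congrArg _ h)
    · exact h₁₂ i j
    · rw [inf_comm]
      exact h₁₂ j i
    · exact h₂ i j fun h => hij (congrArg _ h)

end Codes

theorem theorem2 (F : Type*) [Field F] [Finite F] (k d n₁ n₂ t : ℕ)
    (hd_even : Even d) (hd_pos : 0 < d) (hdk : d ≤ k)
    (hn₁ : k ≤ n₁) (hn₂ : k ≤ n₂) (ht : t ≤ n₁ - k) :
    -- the two MRD codes exist,
    (∃ Q₁ : Submodule F (Matrix (Fin n₁) (Fin k) F), IsLinearMRD (d / 2) Q₁) ∧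
    (∃ Q₂ : Submodule F (Matrix (Fin (n₂ + t)) (Fin k) F), IsLinearMRD (d / 2) Q₂) ∧
    -- and for any choice of them the rank distribution is Delsarte's and the bound holds
    ∀ (Q₁ : Submodule F (Matrix (Fin n₁) (Fin k) F))
      (Q₂ : Submodule F (Matrix (Fin (n₂ + t)) (Fin k) F)),
      IsLinearMRD (d / 2) Q₁ → IsLinearMRD (d / 2) Q₂ →
        (∀ r ∈ Finset.Icc (d / 2) (k - d / 2),
          (rankCount Q₂ r : ℚ) = delsarteCount (Nat.card F) (n₂ + t) k (d / 2) r) ∧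
        Nat.card ↥Q₁ * maxCodeSize F n₂ k d
            + maxCodeSize F (n₁ - t) k d
              * (1 + ∑ r ∈ Finset.Icc (d / 2) (k - d / 2), rankCount Q₂ r)
          ≤ maxCodeSize F (n₁ + n₂) k d := by
  obtain ⟨δ, rfl⟩ := hd_even
  rw [(by omega : (δ + δ) / 2 = δ)]
  have hδ : 1 ≤ δ := by omega
  have hδk : δ ≤ k := by omega
  refine ⟨exists_isLinearMRD F hδ hδk hn₁, exists_isLinearMRD F hδ hδk (by omega),
    fun Q₁ Q₂ hQ₁ hQ₂ => ⟨fun r hr => ?_, ?_⟩⟩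
  · obtain ⟨h1, h2⟩ := Finset.mem_Icc.1 hr
    exact hQ₂.rankCount_eq hδ (by omega) h1 (by omega)
  · rw [← hQ₂.natCard_rank_le hδ]
    exact hQ₁.linkage_le_maxCodeSize hδ hδk (by omega) hQ₂
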